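/- Let $p$ be an odd prime. For an integer $s\ge 0$ let $$\Phi_s(t,z)=\big((t-z_1)(t-z_2)(t-z_3)\big)^{(p^s-1)/2},\qquad z=(z_1,z_2,z_3),$$ and let $T_s(z)\in\mathbb Z[z_1,z_2,z_3]$ be the coefficient of $t^{p^s-1}$ in $\Phi_s(t,z)$ (so $T_0=1$). Put $\bar T_1=(-1)^{(p-1)/2}T_1$ and $$\mathfrak D=\{z\in\mathbb Z_p^3 \;:\; |\bar T_1(z)|_p=1\}.$$ For $i,j\in\{1,2,3\}$ and $s\ge 1$ consider the rational functions $$\eta_s^{(i)}=\frac{\partial T_s}{\partial z_i}\Big/T_s,\qquad \eta_s^{(ij)}=\frac{\partial^2 T_s}{\partial z_i\,\partial z_j}\Big/T_s .$$ Theorem. For every $s\ge 1$ the rational functions $\eta_s^{(i)}$ and $\eta_s^{(ij)}$ are regular on $\mathfrak D$; indeed $T_s$ has no zero on $\mathfrak D$. As $s\to\infty$, the sequences $(\eta_s^{(i)})_{s\ge1}$ and $(\eta_s^{(ij)})_{s\ge1}$ converge uniformly on $\mathfrak D$ to functions $\eta^{(i)}$ and $\eta^{(ij)}$ which are analytic on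 $\mathfrak D$: around every $a\in\mathfrak D$ each of them is the sum, on the whole polydisc $\{z\in\mathbb Q_p^3: |z_k-a_k|_p<1,\ k=1,2,3\}\subset\mathfrak D$, of a power series in $z-a$ with radius of convergence at least $1$. On $\mathfrak D$ these limits satisfy $$\eta^{(1)}+\eta^{(2)}+\eta^{(3)}=0,$$ $$\eta^{(j1)}+\eta^{(j2)}+\eta^{(j3)}=0\qquad (j=1,2,3),$$ $$\frac{\partial}{\partial z_j}\eta^{(i)}=\eta^{(ji)}-\eta^{(i)}\eta^{(j)}\qquad (i,j=1,2,3).$$ -/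

import Mathlib

open Filter Topology

noncomputable section

namespace KZGhost

/-- The master polynomial `Φ_s(t, z) = ((t - z₁)(t - z₂)(t - z₃))^((p^s - 1)/2)`, as a polynomial
in `t` over `ℤ[z₁, z₂, z₃]`. For odd `p` the exponent is an honest half. -/
def masterPoly (p s : ℕ) : Polynomial (MvPolynomial (Fin 3) ℤ) :=
  (∏ i : Fin 3, (Polynomial.X - Polynomial.C (MvPolynomial.X i))) ^ ((p ^ s - 1) / 2)

/-- The `p^s`-approximation polynomial `T_s(z)`: the coefficient of `t^(p^s - 1)` in `Φ_s(t, z)`.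
For `s = 0` this gives `T_0 = 1`. -/
def T (p s : ℕ) : MvPolynomial (Fin 3) ℤ :=
  (masterPoly p s).coeff (p ^ s - 1)

/-- `T̄_s(z) = (-1)^((p^s - 1)/2) T_s(z)`. -/
def Tbar (p s : ℕ) : MvPolynomial (Fin 3) ℤ :=
  (-1) ^ ((p ^ s - 1) / 2) * T p s

/-- The domain `𝔇 = {z ∈ ℤ_p³ : |T̄_1(z)|_p = 1}`, as a subset of `ℚ_p³`. -/
def domain (p : ℕ) [Fact p.Prime] : Set (Fin 3 → ℚ_[p]) :=
  {z | (∀ i, ‖z i‖ ≤ 1) ∧ ‖MvPolynomial.aeval z (Tbar p 1)‖ = 1}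

/-- The value at `z` of `η_s^{(i)} = (∂T_s/∂z_i) / T_s`. -/
def etaOne (p : ℕ) [Fact p.Prime] (s : ℕ) (i : Fin 3) (z : Fin 3 → ℚ_[p]) : ℚ_[p] :=
  MvPolynomial.aeval z (MvPolynomial.pderiv i (T p s)) / MvPolynomial.aeval z (T p s)

/-- The value at `z` of `η_s^{(ij)} = (∂²T_s/∂z_i∂z_j) / T_s`. -/
def etaTwo (p : ℕ) [Fact p.Prime] (s : ℕ) (i j : Fin 3) (z : Fin 3 → ℚ_[p]) : ℚ_[p] :=
  MvPolynomial.aeval z (MvPolynomial.pderiv i (MvPolynomial.pderiv j (T p s))) /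
    MvPolynomial.aeval z (T p s)

/-- `g` is analytic on `D`: around every `a ∈ D` it is the sum of one power series in `z - a`
on the whole open unit polydisc `{z : |z_i - a_i|_p < 1}` (the norm on `Fin 3 → ℚ_[p]` is the
sup norm, and the radius of convergence is at least `1`). In particular `g` is analytic at every
point of `D` in the usual sense. -/
def IsAnalyticOn {p : ℕ} [Fact p.Prime] (g : (Fin 3 → ℚ_[p]) → ℚ_[p])
    (D : Set (Fin 3 → ℚ_[p])) : Prop :=
  ∀ a ∈ D, ∃ P : FormalMultilinearSeries ℚ_[p] (Fin 3 → ℚ_[p]) ℚ_[p],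
    HasFPowerSeriesOnBall g P a 1

end KZGhost

end

/-! The engine is Dwork's: with `F = Φ_1` one has `Φ_s = F ^ (1 + p + ⋯ + p ^ (s - 1))`. Relative to
the Frobenius lift `(t, z) ↦ (t ^ p, z ^ p)`, the ghost terms of this sequence are divisible by
growing powers of `p` (`pow_dvd_ghostTerm`). Their degrees in `t` are small enough for the extracted
coefficients to factor, so `T_s` inherits a ghost decomposition (`T_succ_eq_sum`). This yields
`T_{s+2} / σ(T_{s+1}) ≡ T_{s+1} / σ(T_s)` modulo `p ^ (s + 1)`, where `σ` is `z ↦ z ^ p`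
(`dwork_congruence`).

Differentiating a function of `z ^ p` produces a factor `p`. By induction the logarithmic
derivatives of `T_{s+1}` and `T_s` therefore agree modulo `p ^ s` (`pow_dvd_wronskian`), and second
derivatives follow. Modulo `p`, `T_{s+1} ≡ T_1 * T_s ^ p`, so every `T_s` is a unit on the domain.
Taylor series of the quotients at a point then have integral coefficients and converge
coefficientwise, which gives uniform convergence and analyticity together (`exists_analytic_limit`).

The linear relations come from translation invariance of `Φ_s`, which makes `∑ ∂T_s/∂z_i` divisible
by `p ^ s`. The differential relation is the quotient rule with an error bound independent of `s`,
so it survives the limit. -/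

noncomputable section

namespace KZGhost

/-! ### Ghost terms and formal Dwork congruences. -/

section Congruences

variable {R : Type*} [CommRing R]

/-- If `σ` lifts the Frobenius modulo `p`, then `σ ^ k` lifts its `k`-th iterate. -/
theorem dvd_pow_apply_sub_pow {p : ℕ} {σ : R →+* R} (hσ : ∀ x, (p : R) ∣ σ x - x ^ p) (k : ℕ)
    (x : R) : (p : R) ∣ (σ ^ k) x - x ^ p ^ k := by
  induction k with
  | zero => simp
  | succ k ih =>
    have h1 : (p : R) ∣ σ ((σ ^ k) x) - σ (x ^ p ^ k) := by
      rw [← map_sub]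
      simpa using map_dvd σ ih
    have h2 := hσ (x ^ p ^ k)
    have h3 := dvd_add h1 h2
    rw [pow_succ' σ, RingHom.mul_def, RingHom.comp_apply, pow_succ p, pow_mul]
    simpa using h3

/-- The higher congruences between powers of `x` and of its images under a Frobenius lift. -/
theorem pow_dvd_pow_sub_apply_pow {p : ℕ} {σ : R →+* R} (hσ : ∀ x, (p : R) ∣ σ x - x ^ p)
    (k m : ℕ) (x : R) : (p : R) ^ (m + 1) ∣ x ^ p ^ (k + m) - (σ ^ k) (x ^ p ^ m) := by
  have h := dvd_sub_pow_of_dvd_sub (dvd_pow_apply_sub_pow hσ k x) m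
  rw [← neg_sub, dvd_neg, map_pow, pow_add p k m, pow_mul x]
  exact h

/-- The ghost terms of a sequence `Φ` relative to an endomorphism `τ`. -/
def ghostTerm (τ : R →+* R) (Φ : ℕ → R) : ℕ → R
  | n => Φ (n + 1) - ∑ k : Fin n, ghostTerm τ Φ k * (τ ^ ((k : ℕ) + 1)) (Φ (n - k))
decreasing_by exact k.2

theorem ghostTerm_eq (τ : R →+* R) (Φ : ℕ → R) (n : ℕ) :
    ghostTerm τ Φ n =
      Φ (n + 1) - ∑ k ∈ Finset.range n, ghostTerm τ Φ k * (τ ^ (k + 1)) (Φ (n - k)) := by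
  rw [ghostTerm, Finset.sum_range (fun k => ghostTerm τ Φ k * (τ ^ (k + 1)) (Φ (n - k)))]

theorem eq_sum_ghostTerm (τ : R →+* R) (Φ : ℕ → R) (h0 : Φ 0 = 1) (n : ℕ) :
    Φ (n + 1) = ∑ k ∈ Finset.range (n + 1), ghostTerm τ Φ k * (τ ^ (k + 1)) (Φ (n - k)) := by
  rw [Finset.sum_range_succ, Nat.sub_self, h0, map_one, mul_one, ghostTerm_eq τ Φ n]
  ring

/-- The ghost terms of `n ↦ f ^ (1 + p + ⋯ + p ^ (n - 1))` are highly divisible by `p`. -/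
theorem pow_dvd_ghostTerm {p : ℕ} {τ : R →+* R} (hτ : ∀ x, (p : R) ∣ τ x - x ^ p) {f : R}
    {Φ : ℕ → R} (h0 : Φ 0 = 1) (hΦ : ∀ n, Φ (n + 1) = Φ n * f ^ p ^ n) (n : ℕ) :
    (p : R) ^ n ∣ ghostTerm τ Φ n := by
  induction n using Nat.strong_induction_on with
  | _ n ih =>
    rcases n with _ | n
    · simp
    -- Expanding `Φ (n + 1)` inside `Φ (n + 2) = Φ (n + 1) * f ^ p ^ (n + 1)` pairs the terms. The
    -- ghost term supplies `p ^ k`, the difference of powers `p ^ (n - k + 1)`.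
    have key : ghostTerm τ Φ (n + 1) = ∑ k ∈ Finset.range (n + 1),
        ghostTerm τ Φ k * (τ ^ (k + 1)) (Φ (n - k)) *
          (f ^ p ^ (n + 1) - (τ ^ (k + 1)) (f ^ p ^ (n - k))) := by
      rw [ghostTerm_eq, hΦ (n + 1), eq_sum_ghostTerm τ Φ h0 n, Finset.sum_mul,
        ← Finset.sum_sub_distrib]
      refine Finset.sum_congr rfl fun k hk => ?_
      have hk' : n + 1 - k = n - k + 1 := by
        have := Finset.mem_range.1 hk
        omega
      rw [hk', hΦ (n - k), map_mul]
      ring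
    rw [key]
    refine Finset.dvd_sum fun k hk => ?_
    have hk' := Finset.mem_range.1 hk
    have h1 := pow_dvd_pow_sub_apply_pow hτ (k + 1) (n - k) f
    rw [show k + 1 + (n - k) = n + 1 by omega] at h1
    have h2 := mul_dvd_mul ((ih k hk').mul_right ((τ ^ (k + 1)) (Φ (n - k)))) h1
    rwa [← pow_add, show k + (n - k + 1) = n + 1 by omega] at h2

variable {p : ℕ} {σ : R →+* R} {T I : ℕ → R}

theorem not_dvd_pow_apply (hp : Prime (p : R)) (hσ : ∀ x, (p : R) ∣ σ x - x ^ p) {x : R}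
    (hx : ¬ (p : R) ∣ x) (k : ℕ) : ¬ (p : R) ∣ (σ ^ k) x := fun h =>
  hx (hp.dvd_of_dvd_pow ((dvd_sub_right h).1 (dvd_pow_apply_sub_pow hσ k x)))

theorem pow_dvd_pow_apply {m : ℕ} {x : R} (k : ℕ) (h : (p : R) ^ m ∣ x) :
    (p : R) ^ m ∣ (σ ^ k) x := by
  have h' := map_dvd (σ ^ k) h
  rwa [map_pow, map_natCast] at h'

/-- Formal **Dwork congruences**: a sequence admitting a ghost decomposition satisfies
`T (s + 2) / σ (T (s + 1)) ≡ T (s + 1) / σ (T s)` modulo `p ^ (s + 1)`. -/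
theorem dwork_congruence [IsDomain R] (hp : Prime (p : R)) (hσ : ∀ x, (p : R) ∣ σ x - x ^ p)
    (hT : ∀ n, ¬ (p : R) ∣ T n) (hI : ∀ k, (p : R) ^ k ∣ I k)
    (hrec : ∀ n, T (n + 1) = ∑ k ∈ Finset.range (n + 1), I k * (σ ^ (k + 1)) (T (n - k)))
    (s : ℕ) : (p : R) ^ (s + 1) ∣ T (s + 2) * σ (T s) - T (s + 1) * σ (T (s + 1)) := by
  induction s using Nat.strong_induction_on with
  | _ s ih =>
    -- Telescoped form of earlier congruences: `T (s + 1) / T s` against `σ ^ j` of the ratio `j`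
    -- steps down. Each step applies `σ ^ j` to an earlier case and cancels a factor prime to `p`.
    have hE : ∀ j ≤ s, (p : R) ^ (s - j + 1) ∣
        T (s + 1) * (σ ^ j) (T (s - j)) - T s * (σ ^ j) (T (s + 1 - j)) := by
      intro j
      induction j with
      | zero =>
        intro _
        simp [mul_comm]
      | succ j ihj =>
        intro hj
        have h1 := ihj (by omega)
        obtain ⟨r, hr⟩ : ∃ r, s = r + (j + 1) := ⟨s - (j + 1), by omega⟩
        have h2 := pow_dvd_pow_apply (σ := σ) j (ih r (by omega))
        rw [show s - j = r + 1 by omega, show s + 1 - j = r + 2 by omega] at h1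
        rw [show s - (j + 1) = r by omega, show s + 1 - (j + 1) = r + 1 by omega]
        have hs : ∀ x, (σ ^ (j + 1)) x = (σ ^ j) (σ x) := fun x => by
          rw [pow_succ, RingHom.mul_def, RingHom.comp_apply]
        simp only [map_sub, map_mul, ← hs] at h2
        refine hp.pow_dvd_of_dvd_mul_right _ (not_dvd_pow_apply hp hσ (hT (r + 1)) j) ?_
        have h3 := dvd_add (((pow_dvd_pow (p : R) (Nat.le_succ (r + 1))).trans h1).mul_left
          ((σ ^ (j + 1)) (T r))) (h2.mul_left (T s))
        convert h3 using 1
        ring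
    -- Expanding `T (s + 2)` and `T (s + 1)` by the recursion leaves one unpaired term, `k = s + 1`;
    -- in the others `I k` gives `p ^ k` and `hE` gives `p ^ (s - k + 1)`.
    have key : T (s + 2) * σ (T s) - T (s + 1) * σ (T (s + 1)) =
        I (s + 1) * (σ ^ (s + 2)) (T 0) * σ (T s) - ∑ k ∈ Finset.range (s + 1), I k *
          σ (T (s + 1) * (σ ^ k) (T (s - k)) - T s * (σ ^ k) (T (s + 1 - k))) := by
      have hs : ∀ k x, (σ ^ (k + 1)) x = σ ((σ ^ k) x) := fun k x => by
        rw [pow_succ', RingHom.mul_def, RingHom.comp_apply]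
      have h1 : T (s + 1) * σ (T (s + 1)) = (∑ k ∈ Finset.range (s + 1),
          I k * (σ ^ (k + 1)) (T (s - k))) * σ (T (s + 1)) := by rw [← hrec s]
      rw [h1, hrec (s + 1), Finset.sum_range_succ, Nat.sub_self, add_mul,
        Finset.sum_mul, Finset.sum_mul, add_comm, add_sub_assoc,
        ← Finset.sum_sub_distrib, sub_eq_add_neg, ← Finset.sum_neg_distrib]
      congr 1
      refine Finset.sum_congr rfl fun k _ => ?_
      simp only [hs, map_sub, map_mul]
      ring
    rw [key]
    refine dvd_sub (((hI (s + 1)).mul_right _).mul_right _) (Finset.dvd_sum fun k hk => ?_)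
    have hk' := Finset.mem_range.1 hk
    have h2 := mul_dvd_mul (hI k) (pow_dvd_pow_apply (σ := σ) 1 (hE k (by omega)))
    rwa [← pow_add, show k + (s - k + 1) = s + 1 by omega, pow_one] at h2

theorem pow_dvd_derivation {m : ℕ} {x : R} (D : Derivation ℤ R R) (h : (p : R) ^ m ∣ x) :
    (p : R) ^ m ∣ D x := by
  obtain ⟨y, rfl⟩ := h
  have h0 : D ((p : R) ^ m) = 0 := by
    rw [← Nat.cast_pow]
    exact D.map_natCast _
  rw [Derivation.leibniz, h0, smul_zero, add_zero, smul_eq_mul]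
  exact dvd_mul_right _ _

/-- The logarithmic derivatives of a sequence satisfying the Dwork congruences form a `p`-adic
Cauchy sequence. -/
theorem pow_dvd_wronskian [IsDomain R] (hp : Prime (p : R)) (hσ : ∀ x, (p : R) ∣ σ x - x ^ p)
    (hT : ∀ n, ¬ (p : R) ∣ T n)
    (hdw : ∀ s, (p : R) ^ (s + 1) ∣ T (s + 2) * σ (T s) - T (s + 1) * σ (T (s + 1)))
    (D : Derivation ℤ R R) {w : R} (hD : ∀ x, D (σ x) = p * w * σ (D x)) (s : ℕ) :
    (p : R) ^ s ∣ D (T (s + 1)) * T s - T (s + 1) * D (T s) := by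
  induction s with
  | zero => simp
  | succ s ih =>
    have hc : ¬ (p : R) ∣ σ (T s) := by simpa using not_dvd_pow_apply hp hσ (hT s) 1
    -- The factor `σ (T s) ^ 2` clears denominators. Then `h2` differentiates the Dwork congruence,
    -- and the `p` from `D ∘ σ` raises the inductive exponent by one.
    refine hp.pow_dvd_of_dvd_mul_right _ hc (hp.pow_dvd_of_dvd_mul_right _ hc ?_)
    have h1 := hdw s
    have h2 := pow_dvd_derivation D h1
    have h3 : (p : R) ^ (s + 1) ∣ p * σ (D (T (s + 1)) * T s - T (s + 1) * D (T s)) := by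
      rw [pow_succ']
      exact mul_dvd_mul_left _ (by simpa using pow_dvd_pow_apply (σ := σ) 1 ih)
    simp only [map_sub, map_mul, Derivation.leibniz, hD, smul_eq_mul] at h2 h3
    have h4 := dvd_add (dvd_sub (h2.mul_left (T (s + 1) * σ (T s)))
      (h1.mul_left (D (T (s + 1)) * σ (T s) + T (s + 1) * (p * w * σ (D (T s))))))
      (h3.mul_left (T (s + 1) ^ 2 * w))
    convert h4 using 1
    ring

/-- Applying `D` to the Wronskian for `E` leaves the cross terms `E a * D b - D a * E b`. After
multiplication by `b`, the two first-order hypotheses absorb them. -/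
theorem pow_dvd_wronskian₂ [IsDomain R] (hp : Prime (p : R)) {m : ℕ} {a b : R}
    (hb : ¬ (p : R) ∣ b) (D E : Derivation ℤ R R) (hD : (p : R) ^ m ∣ D a * b - a * D b)
    (hE : (p : R) ^ m ∣ E a * b - a * E b) :
    (p : R) ^ m ∣ D (E a) * b - a * D (E b) := by
  refine hp.pow_dvd_of_dvd_mul_right _ hb ?_
  have h1 := pow_dvd_derivation D hE
  simp only [map_sub, Derivation.leibniz, smul_eq_mul] at h1
  have h2 := dvd_add (dvd_sub (h1.mul_left b) (hE.mul_left (D b))) (hD.mul_left (E b))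
  convert h2 using 1
  ring

end Congruences

/-! ### Frobenius lifts on the polynomial rings. -/

section Frobenius

/-- The endomorphism `z ↦ z ^ p` of `ℤ[z₁, z₂, z₃]`. -/
def frob (p : ℕ) : MvPolynomial (Fin 3) ℤ →+* MvPolynomial (Fin 3) ℤ :=
  (MvPolynomial.expand (σ := Fin 3) (R := ℤ) p : MvPolynomial (Fin 3) ℤ →+* _)

/-- The endomorphism `(t, z) ↦ (t ^ p, z ^ p)` of `ℤ[z₁, z₂, z₃][t]`. -/
def polyFrob (p : ℕ) :
    Polynomial (MvPolynomial (Fin 3) ℤ) →+* Polynomial (MvPolynomial (Fin 3) ℤ) :=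
  (Polynomial.expand (MvPolynomial (Fin 3) ℤ) p : _ →+* _).comp (Polynomial.mapRingHom (frob p))

theorem prime_natCast {p : ℕ} (hp : p.Prime) : Prime (p : MvPolynomial (Fin 3) ℤ) := by
  have h := (MvPolynomial.prime_C_iff (Fin 3)).2 (Nat.prime_iff_prime_int.1 hp)
  simpa using h

theorem not_isUnit_natCast {p : ℕ} (hp : p.Prime) :
    ¬ IsUnit (p : Polynomial (MvPolynomial (Fin 3) ℤ)) := by
  have h := (Polynomial.prime_C_iff.2 (prime_natCast hp)).not_isUnit
  simpa using h

theorem polyFrob_pow_apply {p : ℕ} (k : ℕ) (x : Polynomial (MvPolynomial (Fin 3) ℤ)) :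
    (polyFrob p ^ k) x =
      Polynomial.expand (MvPolynomial (Fin 3) ℤ) (p ^ k) (x.map (frob p ^ k)) := by
  induction k with
  | zero => simp [RingHom.one_def]
  | succ k ih =>
    rw [pow_succ', RingHom.mul_def, RingHom.comp_apply, ih, polyFrob, RingHom.comp_apply,
      Polynomial.coe_mapRingHom, Polynomial.map_expand, Polynomial.map_map, ← RingHom.mul_def,
      ← pow_succ', RingHom.coe_coe, Polynomial.expand_expand, ← pow_succ']

theorem pderiv_frob {p : ℕ} (i : Fin 3) (x : MvPolynomial (Fin 3) ℤ) :
    MvPolynomial.pderiv i (frob p x) =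
      (p : MvPolynomial (Fin 3) ℤ) * MvPolynomial.X i ^ (p - 1) * frob p (MvPolynomial.pderiv i x) := by
  induction x using MvPolynomial.induction_on with
  | C a => simp [frob]
  | add x y hx hy => rw [map_add, map_add, hx, hy, map_add, map_add, mul_add]
  | mul_X x j hx =>
    rw [map_mul, Derivation.leibniz, hx, Derivation.leibniz]
    rcases eq_or_ne j i with rfl | hij
    · simp [frob, Derivation.leibniz_pow]
      ring
    · simp [frob, Derivation.leibniz_pow, MvPolynomial.pderiv_X_of_ne hij]
      ring

variable {p : ℕ} [hp : Fact p.Prime]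

theorem dvd_frob_sub_pow (x : MvPolynomial (Fin 3) ℤ) :
    (p : MvPolynomial (Fin 3) ℤ) ∣ frob p x - x ^ p := by
  have := CharP.quotient (MvPolynomial (Fin 3) ℤ) p (prime_natCast hp.out).not_isUnit
  -- Modulo `p` the power map is a ring homomorphism, so agreement on constants and variables
  -- suffices.
  have h : (Ideal.Quotient.mk (Ideal.span {(p : MvPolynomial (Fin 3) ℤ)})).comp (frob p) =
      (frobenius _ p).comp (Ideal.Quotient.mk _) := by
    refine MvPolynomial.ringHom_ext (fun r => ?_) (fun i => ?_)
    · exact RingHom.congr_fun (RingHom.ext_int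
        (((Ideal.Quotient.mk (Ideal.span {(p : MvPolynomial (Fin 3) ℤ)})).comp
          (frob p)).comp MvPolynomial.C)
        (((frobenius _ p).comp (Ideal.Quotient.mk _)).comp MvPolynomial.C)) r
    · simp [frob, frobenius_def]
  rw [← Ideal.mem_span_singleton, ← Ideal.Quotient.eq, map_pow]
  exact RingHom.congr_fun h x

theorem dvd_polyFrob_sub_pow (x : Polynomial (MvPolynomial (Fin 3) ℤ)) :
    (p : Polynomial (MvPolynomial (Fin 3) ℤ)) ∣ polyFrob p x - x ^ p := by
  have := CharP.quotient (Polynomial (MvPolynomial (Fin 3) ℤ)) p (not_isUnit_natCast hp.out)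
  have h : (Ideal.Quotient.mk
      (Ideal.span {(p : Polynomial (MvPolynomial (Fin 3) ℤ))})).comp (polyFrob p) =
      (frobenius (Polynomial (MvPolynomial (Fin 3) ℤ) ⧸
        Ideal.span {(p : Polynomial (MvPolynomial (Fin 3) ℤ))}) p).comp (Ideal.Quotient.mk _) := by
    refine Polynomial.ringHom_ext (fun r => ?_) ?_
    · have h1 := map_dvd (Polynomial.C (R := MvPolynomial (Fin 3) ℤ))
        (dvd_frob_sub_pow (p := p) r)
      rw [map_natCast, map_sub, ← Ideal.mem_span_singleton, ← Ideal.Quotient.eq] at h1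
      simpa [polyFrob, frobenius_def] using h1
    · simp [polyFrob, frobenius_def]
  rw [← Ideal.mem_span_singleton, ← Ideal.Quotient.eq, map_pow]
  exact RingHom.congr_fun h x

end Frobenius

/-! ### Coefficient extraction. -/

section Coefficients

variable {A : Type*} [CommRing A]

/-- Only exponents `i ≡ q - 1` modulo `q` of `V` can contribute, and the degree bound leaves `i = q
- 1` alone. -/
theorem coeff_mul_expand {q : ℕ} (hq : 0 < q) {V : Polynomial A} (hV : V.natDegree < 2 * q - 1)
    (g : Polynomial A) (M : ℕ) :
    (V * Polynomial.expand A q g).coeff (q * M + (q - 1)) = V.coeff (q - 1) * g.coeff M := by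
  rw [Polynomial.coeff_mul, Finset.sum_eq_single (q - 1, q * M)]
  · rw [mul_comm q M, Polynomial.coeff_expand_mul hq]
  · rintro ⟨i, j⟩ hij hne
    rw [Finset.HasAntidiagonal.mem_antidiagonal] at hij
    simp only at hij
    by_contra h
    have hi : i < 2 * q - 1 := by
      by_contra hi
      exact h (by rw [Polynomial.coeff_eq_zero_of_natDegree_lt (by omega), zero_mul])
    have hj : q ∣ j := by
      by_contra hj
      exact h (by rw [Polynomial.coeff_expand hq, if_neg hj, mul_zero])
    obtain ⟨l, rfl⟩ := hj
    have hlM : l = M := by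
      rcases lt_trichotomy l M with hl | hl | hl
      · have := Nat.mul_le_mul_left q hl
        rw [Nat.mul_succ] at this
        omega
      · exact hl
      · have := Nat.mul_le_mul_left q hl
        rw [Nat.mul_succ] at this
        omega
    subst hlM
    exact hne (by rw [Prod.mk.injEq]; omega)
  · intro h
    exact absurd (Finset.HasAntidiagonal.mem_antidiagonal.2 (by simp only; omega)) h

end Coefficients

/-! ### Ghost decomposition of `T_s`. -/

section Truncations

variable {p : ℕ}

/-- Recursion for the exponent `(p ^ s - 1) / 2` of the master polynomial. -/
theorem half_pow_succ (hp : Odd p) (s : ℕ) :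
    (p ^ (s + 1) - 1) / 2 = (p ^ s - 1) / 2 + (p - 1) / 2 * p ^ s := by
  obtain ⟨a, ha⟩ := hp
  obtain ⟨b, hb⟩ : Odd (p ^ s) := Odd.pow ⟨a, ha⟩
  rw [pow_succ, hb, ha]
  have h : (2 * b + 1) * (2 * a + 1) - 1 = 2 * (b + a * (2 * b + 1)) := by
    rw [Nat.sub_eq_iff_eq_add (by nlinarith)]
    ring
  rw [h]
  simp

theorem half_pow_add (hp : Odd p) (k m : ℕ) :
    (p ^ (k + m) - 1) / 2 = (p ^ k - 1) / 2 + p ^ k * ((p ^ m - 1) / 2) := by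
  obtain ⟨a, ha⟩ : Odd (p ^ k) := hp.pow
  obtain ⟨b, hb⟩ : Odd (p ^ m) := hp.pow
  rw [pow_add, hb, ha]
  have h : (2 * a + 1) * (2 * b + 1) - 1 = 2 * (a + (2 * a + 1) * b) := by
    rw [Nat.sub_eq_iff_eq_add (by nlinarith)]
    ring
  rw [h]
  simp

theorem masterPoly_zero (p : ℕ) : masterPoly p 0 = 1 := by simp [masterPoly]

theorem masterPoly_succ (hp : Odd p) (s : ℕ) :
    masterPoly p (s + 1) = masterPoly p s * (masterPoly p 1) ^ p ^ s := by
  rw [masterPoly, masterPoly, masterPoly, pow_one, half_pow_succ hp, pow_add, pow_mul]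

theorem natDegree_masterPoly_le (p s : ℕ) :
    (masterPoly p s).natDegree ≤ 3 * ((p ^ s - 1) / 2) := by
  rw [masterPoly, mul_comm]
  refine Polynomial.natDegree_pow_le_of_le _ ?_
  refine (Polynomial.natDegree_prod_le _ _).trans ?_
  simp

theorem T_zero (p : ℕ) : T p 0 = 1 := by simp [T, masterPoly_zero]

/-- By `half_pow_add`, every product in the recursion obeys the same degree bound as `Φ_{n+1}`. With
`q = p ^ (n + 1)`, `3 * (q - 1) / 2 < 2 * q - 1`, as `coeff_mul_expand` requires. -/
theorem natDegree_ghostTerm_le (hp : Odd p) (n : ℕ) :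
    (ghostTerm (polyFrob p) (masterPoly p) n).natDegree ≤ 3 * ((p ^ (n + 1) - 1) / 2) := by
  induction n using Nat.strong_induction_on with
  | _ n ih =>
    rw [ghostTerm_eq]
    refine (Polynomial.natDegree_sub_le _ _).trans
      (max_le (natDegree_masterPoly_le _ _) (Polynomial.natDegree_sum_le_of_forall_le _ _ ?_))
    intro k hk
    have hk' := Finset.mem_range.1 hk
    refine Polynomial.natDegree_mul_le.trans ?_
    rw [polyFrob_pow_apply, Polynomial.natDegree_expand]
    have h1 := ih k hk'
    have h2 : ((masterPoly p (n - k)).map (frob p ^ (k + 1))).natDegree ≤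
        3 * ((p ^ (n - k) - 1) / 2) :=
      Polynomial.natDegree_map_le.trans (natDegree_masterPoly_le _ _)
    have h3 := half_pow_add hp (k + 1) (n - k)
    rw [show k + 1 + (n - k) = n + 1 by omega] at h3
    have h4 := Nat.mul_le_mul_right (p ^ (k + 1)) h2
    rw [h3]
    calc _ ≤ 3 * ((p ^ (k + 1) - 1) / 2) + 3 * ((p ^ (n - k) - 1) / 2) * p ^ (k + 1) :=
          add_le_add h1 h4
      _ = _ := by ring

/-- The ghost decomposition of the polynomials `T_s`. -/
theorem T_succ_eq_sum (hp : Odd p) (n : ℕ) :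
    T p (n + 1) = ∑ k ∈ Finset.range (n + 1),
      (ghostTerm (polyFrob p) (masterPoly p) k).coeff (p ^ (k + 1) - 1) *
        (frob p ^ (k + 1)) (T p (n - k)) := by
  rw [T, eq_sum_ghostTerm (polyFrob p) (masterPoly p) (masterPoly_zero p) n,
    Polynomial.finsetSum_coeff]
  refine Finset.sum_congr rfl fun k hk => ?_
  have hk' := Finset.mem_range.1 hk
  have hq : 0 < p ^ (k + 1) := pow_pos hp.pos _
  have hm : 0 < p ^ (n - k) := pow_pos hp.pos _
  have hdeg := natDegree_ghostTerm_le hp k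
  obtain ⟨b, hb⟩ : Odd (p ^ (k + 1)) := hp.pow
  have hexp : p ^ (n + 1) - 1 = p ^ (k + 1) * (p ^ (n - k) - 1) + (p ^ (k + 1) - 1) := by
    have h1 : p ^ (n + 1) = p ^ (k + 1) * p ^ (n - k) := by
      rw [← pow_add]
      congr 1
      omega
    have h2 := Nat.mul_le_mul_left (p ^ (k + 1)) hm
    rw [h1, Nat.mul_sub]
    omega
  rw [polyFrob_pow_apply, hexp]
  rw [coeff_mul_expand hq (by omega), Polynomial.coeff_map, T]

end Truncations

/-! ### Congruences and translation invariance for `T_s`. -/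

section Divisibility

/-- At `(1, 0, 0)` the master polynomial is `((t - 1) * t ^ 2) ^ e`. The value is a sign, hence `p`
cannot divide `T_s`. -/
theorem eval_T {p : ℕ} (hp : Odd p) (s : ℕ) :
    MvPolynomial.eval ![1, 0, 0] (T p s) = (-1) ^ ((p ^ s - 1) / 2) := by
  obtain ⟨b, hb⟩ : Odd (p ^ s) := hp.pow
  have h1 : p ^ s - 1 = 2 * ((p ^ s - 1) / 2) := by omega
  set e := (p ^ s - 1) / 2 with he
  clear_value e
  have h2 : (masterPoly p s).map (MvPolynomial.eval ![(1 : ℤ), 0, 0]) =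
      (Polynomial.X - Polynomial.C 1) ^ e * Polynomial.X ^ (2 * e) := by
    rw [masterPoly, ← he, Polynomial.map_pow, Polynomial.map_prod, Fin.prod_univ_three]
    simp only [Polynomial.map_sub, Polynomial.map_X, Polynomial.map_C, MvPolynomial.eval_X,
      Matrix.cons_val, map_zero, sub_zero]
    rw [mul_assoc, ← sq, mul_pow, ← pow_mul]
  rw [T, ← Polynomial.coeff_map, h2, h1, Polynomial.coeff_mul_X_pow', if_pos le_rfl, Nat.sub_self,
    Polynomial.coeff_zero_eq_eval_zero]
  simp

variable {p : ℕ} [hp : Fact p.Prime]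

theorem not_dvd_T (h2 : p ≠ 2) (s : ℕ) : ¬ (p : MvPolynomial (Fin 3) ℤ) ∣ T p s := by
  intro h
  have h' := map_dvd (MvPolynomial.eval ![(1 : ℤ), 0, 0]) h
  rw [eval_T (hp.out.odd_of_ne_two h2), map_natCast] at h'
  exact (Nat.prime_iff_prime_int.1 hp.out).not_isUnit
    (isUnit_of_dvd_unit h' (IsUnit.pow _ isUnit_one.neg))

theorem pow_dvd_coeff_ghostTerm (h2 : p ≠ 2) (k : ℕ) :
    (p : MvPolynomial (Fin 3) ℤ) ^ k ∣
      (ghostTerm (polyFrob p) (masterPoly p) k).coeff (p ^ (k + 1) - 1) := by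
  have h := pow_dvd_ghostTerm (dvd_polyFrob_sub_pow (p := p)) (masterPoly_zero p)
    (masterPoly_succ (hp.out.odd_of_ne_two h2)) k
  rw [← map_natCast (Polynomial.C (R := MvPolynomial (Fin 3) ℤ)), ← map_pow,
    Polynomial.C_dvd_iff_dvd_coeff] at h
  exact h _

/-- The Dwork congruences for the polynomials `T_s`. -/
theorem dwork_congruence_T (h2 : p ≠ 2) (s : ℕ) :
    (p : MvPolynomial (Fin 3) ℤ) ^ (s + 1) ∣
      T p (s + 2) * frob p (T p s) - T p (s + 1) * frob p (T p (s + 1)) :=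
  dwork_congruence (prime_natCast hp.out) dvd_frob_sub_pow (not_dvd_T h2)
    (pow_dvd_coeff_ghostTerm h2) (T_succ_eq_sum (hp.out.odd_of_ne_two h2)) s

theorem dvd_T_succ_sub (h2 : p ≠ 2) (s : ℕ) :
    (p : MvPolynomial (Fin 3) ℤ) ∣ T p (s + 1) - T p 1 * T p s ^ p := by
  have h1 : (p : MvPolynomial (Fin 3) ℤ) ∣ T p (s + 1) - T p 1 * frob p (T p s) := by
    induction s with
    | zero => simp [T_zero]
    | succ s ih =>
      have h3 := (dvd_pow_self (p : MvPolynomial (Fin 3) ℤ) s.succ_ne_zero).trans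
        (dwork_congruence_T h2 s)
      have h4 : ¬ (p : MvPolynomial (Fin 3) ℤ) ∣ frob p (T p s) := by
        simpa using not_dvd_pow_apply (prime_natCast hp.out) dvd_frob_sub_pow
          (not_dvd_T h2 s) 1
      refine ((prime_natCast hp.out).dvd_or_dvd ?_).resolve_right h4
      have h5 := dvd_add h3 (ih.mul_right (frob p (T p (s + 1))))
      convert h5 using 1
      ring
  have h3 := dvd_add h1 ((dvd_frob_sub_pow (p := p) (T p s)).mul_left (T p 1))
  convert h3 using 1
  ring

theorem pow_dvd_wronskian_T (h2 : p ≠ 2) (i : Fin 3) (s : ℕ) :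
    (p : MvPolynomial (Fin 3) ℤ) ^ s ∣ MvPolynomial.pderiv i (T p (s + 1)) * T p s -
      T p (s + 1) * MvPolynomial.pderiv i (T p s) :=
  pow_dvd_wronskian (prime_natCast hp.out) dvd_frob_sub_pow (not_dvd_T h2)
    (dwork_congruence_T h2) (MvPolynomial.pderiv i) (pderiv_frob i) s

theorem pow_dvd_wronskian₂_T (h2 : p ≠ 2) (i j : Fin 3) (s : ℕ) :
    (p : MvPolynomial (Fin 3) ℤ) ^ s ∣
      MvPolynomial.pderiv i (MvPolynomial.pderiv j (T p (s + 1))) * T p s -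
        T p (s + 1) * MvPolynomial.pderiv i (MvPolynomial.pderiv j (T p s)) :=
  pow_dvd_wronskian₂ (prime_natCast hp.out) (not_dvd_T h2 s) (MvPolynomial.pderiv i)
    (MvPolynomial.pderiv j) (pow_dvd_wronskian_T h2 i s) (pow_dvd_wronskian_T h2 j s)

/-- The polynomials `Φ_s` are invariant under simultaneous translations of `t` and `z`. -/
theorem sum_pderiv_coeff_masterPoly (p s n : ℕ) :
    ∑ i : Fin 3, MvPolynomial.pderiv i ((masterPoly p s).coeff n) =
      -((masterPoly p s).coeff (n + 1) * (n + 1)) := by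
  let : Differential (MvPolynomial (Fin 3) ℤ) :=
    ⟨MvPolynomial.pderiv 0 + MvPolynomial.pderiv 1 + MvPolynomial.pderiv 2⟩
  have hd : ∀ x : MvPolynomial (Fin 3) ℤ,
      Differential.deriv x = ∑ i : Fin 3, MvPolynomial.pderiv i x := fun x => by
    rw [Fin.sum_univ_three]
    rfl
  -- The infinitesimal simultaneous translation of `t` and `z`; it kills each `t - z_j`, hence
  -- `Φ_s`.
  let E : Derivation ℤ (Polynomial (MvPolynomial (Fin 3) ℤ)) _ :=
    Differential.mapCoeffs +
      (Polynomial.derivative' (R := MvPolynomial (Fin 3) ℤ)).restrictScalars ℤ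
  have hE : ∀ x, E x = Differential.mapCoeffs x + Polynomial.derivative x := fun x => rfl
  have hlin : ∀ j : Fin 3, E (Polynomial.X - Polynomial.C (MvPolynomial.X j)) = 0 := fun j => by
    rw [hE]
    simp [hd, MvPolynomial.pderiv_X, Pi.single_apply]
  have h0 : E (masterPoly p s) = 0 := by
    rw [masterPoly, Derivation.leibniz_pow, Fin.prod_univ_three]
    simp only [Derivation.leibniz, hlin, smul_zero, add_zero]
  have h := congrArg (fun f => Polynomial.coeff f n) h0
  simp only [hE, Polynomial.coeff_add, Differential.coeff_mapCoeffs, hd,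
    Polynomial.coeff_derivative, Polynomial.coeff_zero] at h
  exact eq_neg_of_add_eq_zero_left h

theorem pow_dvd_sum_pderiv_T {p : ℕ} (hp : 0 < p) (s : ℕ) :
    (p : MvPolynomial (Fin 3) ℤ) ^ s ∣ ∑ i, MvPolynomial.pderiv i (T p s) := by
  have h1 : ((p ^ s - 1 : ℕ) : MvPolynomial (Fin 3) ℤ) + 1 = p ^ s := by
    rw [← Nat.cast_add_one, Nat.sub_add_cancel (Nat.one_le_pow _ _ hp), Nat.cast_pow]
  rw [T, sum_pderiv_coeff_masterPoly, h1]
  exact (dvd_mul_left _ _).neg_right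

end Divisibility

/-! ### Integral power series over the `p`-adic integers. -/

section PowerSeries

variable {p : ℕ} [hp : Fact p.Prime]

instance isLinearTopology_padicInt : IsLinearTopology ℤ_[p] ℤ_[p] := by
  refine IsLinearTopology.mk_of_hasBasis (ι := ℕ) (S := Ideal ℤ_[p]) (p := fun _ => True)
    (s := fun n => Ideal.span {(p : ℤ_[p]) ^ n}) ℤ_[p] ?_
  have hp1 : (1 : ℝ) < p := by exact_mod_cast hp.out.one_lt
  have hb := Metric.nhds_basis_closedBall_pow (x := (0 : ℤ_[p])) (r := (p : ℝ)⁻¹)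
    (by positivity) (inv_lt_one_of_one_lt₀ hp1)
  convert hb using 2 with n
  ext x
  rw [SetLike.mem_coe, ← PadicInt.norm_le_pow_iff_mem_span_pow, mem_closedBall_zero_iff,
    zpow_neg, zpow_natCast, inv_pow]

theorem hasEval_of_norm_lt_one {σ : Type*} [Finite σ] {u : σ → ℤ_[p]} (hu : ∀ i, ‖u i‖ < 1) :
    MvPowerSeries.HasEval u where
  hpow i := tendsto_pow_atTop_nhds_zero_of_norm_lt_one (hu i)
  tendsto_zero := by simp [Filter.cofinite_eq_bot]

theorem norm_le_of_pow_dvd {s : ℕ} {x : ℤ_[p]} (h : (p : ℤ_[p]) ^ s ∣ x) :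
    ‖x‖ ≤ (p : ℝ)⁻¹ ^ s := by
  have := (PadicInt.norm_le_pow_iff_mem_span_pow x s).2 (Ideal.mem_span_singleton.2 h)
  rwa [zpow_neg, zpow_natCast, ← inv_pow] at this

theorem exists_limit_padicInt {x : ℕ → ℤ_[p]} (h : ∀ s, (p : ℤ_[p]) ^ s ∣ x (s + 1) - x s) :
    ∃ L, ∀ s, (p : ℤ_[p]) ^ s ∣ L - x s := by
  have hle : ∀ {m n : ℕ}, m ≤ n → (p : ℤ_[p]) ^ m ∣ x n - x m := by
    intro m n hmn
    induction n, hmn using Nat.le_induction with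
    | base => simp
    | succ n hmn ih =>
      have h1 := dvd_add ((pow_dvd_pow _ hmn).trans (h n)) ih
      simpa using h1
  have hmem : ∀ (n : ℕ) (y : ℤ_[p]), y ∈ (IsLocalRing.maximalIdeal ℤ_[p] ^ n • ⊤ : Ideal ℤ_[p]) ↔
      (p : ℤ_[p]) ^ n ∣ y := fun n y => by
    rw [PadicInt.maximalIdeal_eq_span_p, Ideal.span_singleton_pow, smul_eq_mul, Ideal.mul_top,
      Ideal.mem_span_singleton]
  obtain ⟨L, hL⟩ := IsPrecomplete.prec (I := IsLocalRing.maximalIdeal ℤ_[p]) (M := ℤ_[p])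
    inferInstance (f := x) (fun {m n} hmn => by
      rw [SModEq.sub_mem, hmem, dvd_sub_comm]
      exact hle hmn)
  refine ⟨L, fun s => ?_⟩
  have := hL s
  rwa [SModEq.sub_mem, hmem, dvd_sub_comm] at this

theorem pow_dvd_mvPowerSeries_iff {σ : Type*} {s : ℕ} {f : MvPowerSeries σ ℤ_[p]} :
    (p : MvPowerSeries σ ℤ_[p]) ^ s ∣ f ↔ ∀ d, (p : ℤ_[p]) ^ s ∣ MvPowerSeries.coeff d f := by
  have hC : (p : MvPowerSeries σ ℤ_[p]) ^ s = MvPowerSeries.C ((p : ℤ_[p]) ^ s) := by simp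
  rw [hC]
  constructor
  · rintro ⟨g, rfl⟩ d
    rw [MvPowerSeries.coeff_C_mul]
    exact dvd_mul_right _ _
  · intro h
    choose g hg using h
    obtain ⟨G, hG⟩ : ∃ G : MvPowerSeries σ ℤ_[p], ∀ d, MvPowerSeries.coeff d G = g d :=
      ⟨g, fun _ => rfl⟩
    refine ⟨G, MvPowerSeries.ext fun d => ?_⟩
    rw [MvPowerSeries.coeff_C_mul, hg, hG]

theorem exists_limit_mvPowerSeries {σ : Type*} {q : ℕ → MvPowerSeries σ ℤ_[p]}
    (h : ∀ s, (p : MvPowerSeries σ ℤ_[p]) ^ s ∣ q (s + 1) - q s) :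
    ∃ Q, ∀ s, (p : MvPowerSeries σ ℤ_[p]) ^ s ∣ Q - q s := by
  have h1 : ∀ d, ∃ L, ∀ s, (p : ℤ_[p]) ^ s ∣ L - MvPowerSeries.coeff d (q s) := fun d =>
    exists_limit_padicInt fun s => by simpa using pow_dvd_mvPowerSeries_iff.1 (h s) d
  choose L hL using h1
  obtain ⟨Q, hQ⟩ : ∃ Q : MvPowerSeries σ ℤ_[p], ∀ d, MvPowerSeries.coeff d Q = L d :=
    ⟨L, fun _ => rfl⟩
  refine ⟨Q, fun s => pow_dvd_mvPowerSeries_iff.2 fun d => ?_⟩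
  rw [map_sub, hQ]
  exact hL d s

/-- Every monomial of degree `n` is the diagonal of a continuous multilinear map of norm at most
one. -/
theorem exists_multilinear_monomial (n : ℕ) (d : Fin 3 →₀ ℕ) (hd : d.degree = n) :
    ∃ M : ContinuousMultilinearMap ℚ_[p] (fun _ : Fin n => Fin 3 → ℚ_[p]) ℚ_[p],
      (∀ y, M (fun _ => y) = d.prod fun i e => y i ^ e) ∧ ∀ v, ‖M v‖ ≤ ∏ k, ‖v k‖ := by
  set l := (Finsupp.toMultiset d).toList with hl
  have hlen : l.length = n := by
    rw [hl, Multiset.length_toList, Finsupp.card_toMultiset, ← hd]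
    rfl
  subst hlen
  refine ⟨(ContinuousMultilinearMap.mkPiAlgebra ℚ_[p] (Fin l.length) ℚ_[p]).compContinuousLinearMap
    fun k => ContinuousLinearMap.proj (l.get k), fun y => ?_, fun v => ?_⟩
  · simp only [ContinuousMultilinearMap.compContinuousLinearMap_apply,
      ContinuousMultilinearMap.mkPiAlgebra_apply, ContinuousLinearMap.proj_apply, 
      List.get_eq_getElem]
    rw [Fin.prod_univ_fun_getElem l y, ← Multiset.prod_coe, ← Multiset.map_coe, hl,
      Multiset.coe_toList, Finsupp.toMultiset_map, Finsupp.prod_toMultiset]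
    exact Finsupp.prod_mapDomain_index (by simp) (by simp [pow_add])
  · simp only [ContinuousMultilinearMap.compContinuousLinearMap_apply,
      ContinuousMultilinearMap.mkPiAlgebra_apply, ContinuousLinearMap.proj_apply, norm_prod]
    exact Finset.prod_le_prod (fun _ _ => norm_nonneg _) fun k _ => norm_le_pi_norm (v k) _

/-- A function given on the open unit polydisc by a power series with integral coefficients is the
sum of a formal multilinear series there. -/
theorem exists_hasFPowerSeriesOnBall (Q : MvPowerSeries (Fin 3) ℤ_[p])
    (f : (Fin 3 → ℚ_[p]) → ℚ_[p]) (a : Fin 3 → ℚ_[p])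
    (hf : ∀ (u : Fin 3 → ℤ_[p]) (hu : ∀ i, ‖u i‖ < 1), f (fun i => a i + u i) =
      (MvPowerSeries.aeval (hasEval_of_norm_lt_one hu) Q : ℤ_[p])) :
    ∃ P : FormalMultilinearSeries ℚ_[p] (Fin 3 → ℚ_[p]) ℚ_[p], HasFPowerSeriesOnBall f P a 1 := by
  have hmem : ∀ {n : ℕ} {d : Fin 3 →₀ ℕ}, d ∈ Finset.univ.finsuppAntidiag n ↔ d.degree = n := by
    intro n d
    rw [Finset.mem_finsuppAntidiag, Finsupp.degree_eq_sum]
    simp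
  choose! M hM hMn using fun (n : ℕ) (d : Fin 3 →₀ ℕ) (h : d.degree = n) =>
    exists_multilinear_monomial (p := p) n d h
  refine ⟨fun n => ∑ d ∈ Finset.univ.finsuppAntidiag n,
    ((MvPowerSeries.coeff d Q : ℤ_[p]) : ℚ_[p]) • M n d, ?_, one_pos, ?_⟩
  · rw [← ENNReal.coe_one]
    refine FormalMultilinearSeries.le_radius_of_bound _ 1 fun n => ?_
    -- Integral coefficients and the ultrametric inequality bound each homogeneous part by one.
    rw [NNReal.coe_one, one_pow, mul_one]
    refine ContinuousMultilinearMap.opNorm_le_bound zero_le_one fun v => ?_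
    rw [one_mul, _root_.sum_apply]
    refine IsUltrametricDist.norm_sum_le_of_forall_le_of_nonneg
      (Finset.prod_nonneg fun _ _ => norm_nonneg _) fun d hd => ?_
    rw [_root_.smul_apply, norm_smul]
    exact (mul_le_of_le_one_left (norm_nonneg _) (PadicInt.norm_le_one _)).trans
      (hMn n d (hmem.1 hd) v)
  · intro y hy
    have hy' : ∀ i, ‖y i‖ < 1 := by
      rw [← ENNReal.ofReal_one, Metric.eball_ofReal, mem_ball_zero_iff] at hy
      exact fun i => (norm_le_pi_norm y i).trans_lt hy
    have hfu := hf (fun i => ⟨y i, (hy' i).le⟩) hy'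
    have hsum := (MvPowerSeries.hasSum_aeval (hasEval_of_norm_lt_one
      (u := fun i => (⟨y i, (hy' i).le⟩ : ℤ_[p])) hy') Q).map
        (PadicInt.Coe.ringHom (p := p)) continuous_subtype_val
    -- Monomials are regrouped by total degree to match the multilinear series.
    have hsum' := hsum.tsum_fiberwise (fun d : Fin 3 →₀ ℕ => d.degree)
    have hval : f (a + y) = f (fun i => a i + y i) := rfl
    rw [hval]
    simp only at hfu
    have hcoe : ∀ x : ℤ_[p], PadicInt.Coe.ringHom x = (x : ℚ_[p]) := fun _ => rfl
    rw [hfu, ← hcoe]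
    convert hsum' using 1
    funext n
    have hset : ((fun d : Fin 3 →₀ ℕ => d.degree) ⁻¹' {n}) =
        ((Finset.univ.finsuppAntidiag n : Finset (Fin 3 →₀ ℕ)) : Set (Fin 3 →₀ ℕ)) := by
      ext d
      rw [Finset.mem_coe, hmem]
      rfl
    rw [hset, Finset.tsum_subtype', _root_.sum_apply]
    refine Finset.sum_congr rfl fun d hd => ?_
    rw [_root_.smul_apply, hM n d (hmem.1 hd)]
    simp only [Function.comp_apply, smul_eq_mul, map_mul, Finsupp.prod, map_prod]
    rfl

end PowerSeries

/-! ### Units on the domain and Taylor expansion. -/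

section Domain

variable {p : ℕ} [hp : Fact p.Prime]

theorem aeval_coe_padicInt (x : Fin 3 → ℤ_[p]) (f : MvPolynomial (Fin 3) ℤ) :
    MvPolynomial.aeval (fun i => (x i : ℚ_[p])) f = (MvPolynomial.aeval x f : ℤ_[p]) :=
  MvPolynomial.aeval_algebraMap_apply ℚ_[p] x f

theorem pow_dvd_aeval {s : ℕ} {f : MvPolynomial (Fin 3) ℤ}
    (h : (p : MvPolynomial (Fin 3) ℤ) ^ s ∣ f) (x : Fin 3 → ℤ_[p]) :
    (p : ℤ_[p]) ^ s ∣ MvPolynomial.aeval x f := by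
  simpa using map_dvd (MvPolynomial.aeval x) h

theorem coe_mem_domain_iff {x : Fin 3 → ℤ_[p]} :
    (fun i => (x i : ℚ_[p])) ∈ domain p ↔ IsUnit (MvPolynomial.aeval x (T p 1)) := by
  have h1 : ∀ i, ‖(x i : ℚ_[p])‖ ≤ 1 := fun i => PadicInt.norm_le_one (x i)
  rw [domain, Set.mem_ofPred_eq, and_iff_right h1, aeval_coe_padicInt, PadicInt.isUnit_iff,
    ← PadicInt.norm_def, Tbar]
  simp

theorem exists_coe_eq_of_mem_domain {z : Fin 3 → ℚ_[p]} (hz : z ∈ domain p) :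
    ∃ x : Fin 3 → ℤ_[p], z = fun i => (x i : ℚ_[p]) :=
  ⟨fun i => ⟨z i, hz.1 i⟩, rfl⟩

/-- Modulo `p`, `T_{s+1}` is `T_1 * T_s ^ p`, so invertibility propagates from `T_1`. -/
theorem isUnit_aeval_T (h2 : p ≠ 2) {x : Fin 3 → ℤ_[p]}
    (hx : IsUnit (MvPolynomial.aeval x (T p 1))) (s : ℕ) :
    IsUnit (MvPolynomial.aeval x (T p s)) := by
  induction s with
  | zero => simp [T_zero]
  | succ s ih =>
    have h := pow_dvd_aeval (s := 1) (by simpa using dvd_T_succ_sub h2 s) x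
    rw [pow_one, map_sub, map_mul, map_pow] at h
    by_contra hn
    have h1 : MvPolynomial.aeval x (T p 1) * MvPolynomial.aeval x (T p s) ^ p ∈
        IsLocalRing.maximalIdeal ℤ_[p] := by
      have h3 : MvPolynomial.aeval x (T p (s + 1)) -
          MvPolynomial.aeval x (T p 1) * MvPolynomial.aeval x (T p s) ^ p ∈
            IsLocalRing.maximalIdeal ℤ_[p] := by
        rw [PadicInt.maximalIdeal_eq_span_p, Ideal.mem_span_singleton]
        exact h
      have h4 := Ideal.sub_mem _ ((IsLocalRing.mem_maximalIdeal _).2 hn) h3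
      rwa [sub_sub_cancel] at h4
    exact (IsLocalRing.mem_maximalIdeal _).1 h1 (hx.mul (ih.pow p))

/-- The Taylor expansion of an integral polynomial at `a`, as a power series. -/
def taylor (a : Fin 3 → ℤ_[p]) : MvPolynomial (Fin 3) ℤ →+* MvPowerSeries (Fin 3) ℤ_[p] :=
  (MvPolynomial.aeval fun i => MvPowerSeries.C (a i) + MvPowerSeries.X i :
    MvPolynomial (Fin 3) ℤ →ₐ[ℤ] MvPowerSeries (Fin 3) ℤ_[p])

theorem aeval_taylor (a : Fin 3 → ℤ_[p]) {u : Fin 3 → ℤ_[p]} (hu : MvPowerSeries.HasEval u)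
    (f : MvPolynomial (Fin 3) ℤ) :
    MvPowerSeries.aeval hu (taylor a f) = MvPolynomial.aeval (a + u) f := by
  have h : (MvPowerSeries.aeval hu : MvPowerSeries (Fin 3) ℤ_[p] →ₐ[ℤ_[p]] ℤ_[p]).toRingHom.comp
      (taylor a) =
      (MvPolynomial.aeval (a + u) : MvPolynomial (Fin 3) ℤ →ₐ[ℤ] ℤ_[p]).toRingHom := by
    refine MvPolynomial.ringHom_ext (fun r => by simp [taylor]) fun i => ?_
    have h1 : MvPowerSeries.aeval hu (MvPowerSeries.C (a i)) = a i := by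
      rw [← MvPolynomial.coe_C, MvPowerSeries.aeval_coe, MvPolynomial.aeval_C]
      rfl
    have h3 : MvPowerSeries.aeval hu (MvPowerSeries.X i : MvPowerSeries (Fin 3) ℤ_[p]) = u i := by
      rw [← MvPolynomial.coe_X, MvPowerSeries.aeval_coe, MvPolynomial.aeval_X]
    simp [taylor, h1, h3]
  exact RingHom.congr_fun h f

theorem isUnit_taylor_iff {a : Fin 3 → ℤ_[p]} {f : MvPolynomial (Fin 3) ℤ} :
    IsUnit (taylor a f) ↔ IsUnit (MvPolynomial.aeval a f) := by
  have h : (MvPowerSeries.constantCoeff (σ := Fin 3) (R := ℤ_[p])).comp (taylor a) =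
      (MvPolynomial.aeval a : MvPolynomial (Fin 3) ℤ →ₐ[ℤ] ℤ_[p]).toRingHom :=
    MvPolynomial.ringHom_ext (fun r => by simp [taylor]) fun i => by simp [taylor]
  rw [MvPowerSeries.isUnit_iff_constantCoeff]
  exact iff_of_eq (congrArg IsUnit (RingHom.congr_fun h f))

theorem isUnit_aeval_add {a u : Fin 3 → ℤ_[p]} (hu : ∀ i, ‖u i‖ < 1)
    {f : MvPolynomial (Fin 3) ℤ} (h : IsUnit (MvPolynomial.aeval a f)) :
    IsUnit (MvPolynomial.aeval (a + u) f) := by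
  rw [← aeval_taylor a (hasEval_of_norm_lt_one hu)]
  exact (isUnit_taylor_iff.2 h).map _

end Domain

/-! ### Uniform limits and analyticity. -/

section Limit

variable {p : ℕ} [hp : Fact p.Prime]

theorem pow_dvd_mul_inv_sub {A : Type*} [CommRing A] {q n n' t t' v v' : A} (hv : t * v = 1)
    (hv' : t' * v' = 1) (h : q ∣ n' * t - t' * n) : q ∣ n' * v' - n * v := by
  have h1 := h.mul_left (v * v')
  have h3 : n' * v' - n * v = v * v' * (n' * t - t' * n) := by
    linear_combination (-n' * v') * hv + n * v * hv'
  rwa [h3]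

theorem norm_div_sub_le_of_pow_dvd {s : ℕ} {n t v L : ℤ_[p]} (hv : t * v = 1)
    (h : (p : ℤ_[p]) ^ s ∣ L - n * v) :
    ‖(n : ℚ_[p]) / (t : ℚ_[p]) - L‖ ≤ (p : ℝ)⁻¹ ^ s := by
  have ht : (t : ℚ_[p]) * v = 1 := by exact_mod_cast congrArg (fun y : ℤ_[p] => (y : ℚ_[p])) hv
  rw [div_eq_mul_inv, ← eq_inv_of_mul_eq_one_right ht, norm_sub_rev]
  have := norm_le_of_pow_dvd h
  rw [PadicInt.norm_def] at this
  push_cast at this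
  exact this

theorem eq_of_forall_norm_sub_le {x : ℕ → ℚ_[p]} {a b : ℚ_[p]}
    (ha : ∀ s, ‖x s - a‖ ≤ (p : ℝ)⁻¹ ^ s) (hb : ∀ s, ‖x s - b‖ ≤ (p : ℝ)⁻¹ ^ s) : a = b := by
  have hp1 : (1 : ℝ) < p := by exact_mod_cast hp.out.one_lt
  have h0 := tendsto_pow_atTop_nhds_zero_of_lt_one (r := (p : ℝ)⁻¹) (by positivity)
    (inv_lt_one_of_one_lt₀ hp1)
  exact tendsto_nhds_unique
    (tendsto_iff_norm_sub_tendsto_zero.2 (squeeze_zero (fun _ => norm_nonneg _) ha h0))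
    (tendsto_iff_norm_sub_tendsto_zero.2 (squeeze_zero (fun _ => norm_nonneg _) hb h0))

/-- If the ratios `N_s / T_s` form a formal `p`-adic Cauchy sequence, then they converge on the
domain, at an explicit uniform rate, to an analytic function. -/
theorem exists_analytic_limit (h2 : p ≠ 2) {N : ℕ → MvPolynomial (Fin 3) ℤ}
    (hN : ∀ s, (p : MvPolynomial (Fin 3) ℤ) ^ s ∣ N (s + 1) * T p s - T p (s + 1) * N s) :
    ∃ g : (Fin 3 → ℚ_[p]) → ℚ_[p], (∀ z ∈ domain p, ∀ s,
      ‖MvPolynomial.aeval z (N s) / MvPolynomial.aeval z (T p s) - g z‖ ≤ (p : ℝ)⁻¹ ^ s) ∧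
      IsAnalyticOn g (domain p) := by
  have key : ∀ a : Fin 3 → ℤ_[p], IsUnit (MvPolynomial.aeval a (T p 1)) →
      ∃ Q : MvPowerSeries (Fin 3) ℤ_[p], ∀ (u : Fin 3 → ℤ_[p]) (hu : ∀ i, ‖u i‖ < 1) (s : ℕ),
        ‖MvPolynomial.aeval (fun i => ((a + u) i : ℚ_[p])) (N s) /
          MvPolynomial.aeval (fun i => ((a + u) i : ℚ_[p])) (T p s) -
            (MvPowerSeries.aeval (hasEval_of_norm_lt_one hu) Q : ℤ_[p])‖ ≤ (p : ℝ)⁻¹ ^ s := by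
    intro a ha
    choose V hV using fun s => (isUnit_taylor_iff.2 (isUnit_aeval_T h2 ha s)).exists_right_inv
    obtain ⟨Q, hQ⟩ := exists_limit_mvPowerSeries (q := fun s => taylor a (N s) * V s) fun s => by
      refine pow_dvd_mul_inv_sub (hV s) (hV (s + 1)) ?_
      simpa using map_dvd (taylor a) (hN s)
    refine ⟨Q, fun u hu s => ?_⟩
    have h1 := congrArg (MvPowerSeries.aeval (hasEval_of_norm_lt_one hu)) (hV s)
    have h3 := map_dvd (MvPowerSeries.aeval (hasEval_of_norm_lt_one hu)) (hQ s)
    rw [map_mul, aeval_taylor, map_one] at h1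
    rw [map_pow, map_natCast, map_sub, map_mul, aeval_taylor] at h3
    rw [aeval_coe_padicInt, aeval_coe_padicInt]
    exact norm_div_sub_le_of_pow_dvd h1 h3
  have hex : ∀ z : Fin 3 → ℚ_[p], ∃ w : ℚ_[p], z ∈ domain p → ∀ s,
      ‖MvPolynomial.aeval z (N s) / MvPolynomial.aeval z (T p s) - w‖ ≤ (p : ℝ)⁻¹ ^ s := by
    intro z
    by_cases hz : z ∈ domain p
    · obtain ⟨x, rfl⟩ := exists_coe_eq_of_mem_domain hz
      obtain ⟨Q, hQ⟩ := key x (coe_mem_domain_iff.1 hz)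
      -- The value at the centre, `u = 0`; uniqueness of limits later identifies `g` with `Q` on the
      -- whole polydisc.
      exact ⟨_, fun _ => by simpa using hQ 0 (by simp)⟩
    · exact ⟨0, fun h => absurd h hz⟩
  choose g hg using hex
  refine ⟨g, hg, fun a ha => ?_⟩
  obtain ⟨x, rfl⟩ := exists_coe_eq_of_mem_domain ha
  have hx := coe_mem_domain_iff.1 ha
  obtain ⟨Q, hQ⟩ := key x hx
  refine exists_hasFPowerSeriesOnBall Q g _ fun u hu => ?_
  have hmem := coe_mem_domain_iff.2 (isUnit_aeval_add hu hx)
  have h := eq_of_forall_norm_sub_le (hg _ hmem) (hQ u hu)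
  simpa using h

end Limit

/-! ### The quotient rule with uniform error. -/

section Derivative

variable {p : ℕ} [hp : Fact p.Prime]

theorem aeval_add_single {A : Type*} [CommRing A] (x : Fin 3 → A) (j : Fin 3) (h : A)
    (f : MvPolynomial (Fin 3) ℤ) :
    ∃ r, MvPolynomial.aeval (x + Pi.single j h) f = MvPolynomial.aeval x f +
      h * MvPolynomial.aeval x (MvPolynomial.pderiv j f) + h ^ 2 * r := by
  induction f using MvPolynomial.induction_on with
  | C a => exact ⟨0, by simp⟩
  | add f g hf hg =>
    obtain ⟨r, hr⟩ := hf
    obtain ⟨t, ht⟩ := hg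
    refine ⟨r + t, ?_⟩
    simp only [map_add, hr, ht]
    ring
  | mul_X f i hf =>
    obtain ⟨r, hr⟩ := hf
    simp only [map_mul, Derivation.leibniz, MvPolynomial.aeval_X, Pi.add_apply, hr, map_add,
      smul_eq_mul]
    rcases eq_or_ne i j with rfl | hij
    · refine ⟨MvPolynomial.aeval x (MvPolynomial.pderiv i f) + r * (x i + h), ?_⟩
      rw [Pi.single_eq_same, MvPolynomial.pderiv_X_self, map_one]
      ring
    · refine ⟨r * x i, ?_⟩
      rw [Pi.single_eq_of_ne hij, MvPolynomial.pderiv_X_of_ne hij, map_zero]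
      ring

/-- A quantitative quotient rule for integral polynomials over the `p`-adic integers. -/
theorem norm_div_sub_le_sq (x : Fin 3 → ℤ_[p]) (j : Fin 3) {h : ℤ_[p]} (hh : ‖h‖ < 1)
    (N D : MvPolynomial (Fin 3) ℤ) (hD : IsUnit (MvPolynomial.aeval x D)) :
    ‖(MvPolynomial.aeval (x + Pi.single j h) N : ℤ_[p]) /
        ((MvPolynomial.aeval (x + Pi.single j h) D : ℤ_[p]) : ℚ_[p]) -
      (MvPolynomial.aeval x N : ℤ_[p]) / ((MvPolynomial.aeval x D : ℤ_[p]) : ℚ_[p]) -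
      h * ((MvPolynomial.aeval x (MvPolynomial.pderiv j N) : ℤ_[p]) /
          ((MvPolynomial.aeval x D : ℤ_[p]) : ℚ_[p]) -
        (MvPolynomial.aeval x N : ℤ_[p]) / ((MvPolynomial.aeval x D : ℤ_[p]) : ℚ_[p]) *
        ((MvPolynomial.aeval x (MvPolynomial.pderiv j D) : ℤ_[p]) /
          ((MvPolynomial.aeval x D : ℤ_[p]) : ℚ_[p])))‖ ≤ ‖h‖ ^ 2 := by
  have hu : ∀ i, ‖(Pi.single j h : Fin 3 → ℤ_[p]) i‖ < 1 := fun i => by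
    rcases eq_or_ne i j with rfl | hij
    · rwa [Pi.single_eq_same]
    · rw [Pi.single_eq_of_ne hij, norm_zero]
      exact one_pos
  have hD' := isUnit_aeval_add hu hD
  obtain ⟨r, hr⟩ := aeval_add_single x j h N
  obtain ⟨t, ht⟩ := aeval_add_single x j h D
  obtain ⟨v, hv⟩ := hD.exists_right_inv
  obtain ⟨v', hv'⟩ := hD'.exists_right_inv
  rw [ht] at hv'
  rw [hr, ht]
  generalize MvPolynomial.aeval x N = n at *
  generalize MvPolynomial.aeval x D = d at *
  generalize MvPolynomial.aeval x (MvPolynomial.pderiv j N) = n₁ at *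
  generalize MvPolynomial.aeval x (MvPolynomial.pderiv j D) = d₁ at *
  have hinv : ∀ {y w : ℤ_[p]}, y * w = 1 → ∀ m : ℤ_[p],
      (m : ℚ_[p]) / (y : ℚ_[p]) = ((m * w : ℤ_[p]) : ℚ_[p]) := fun {y w} hyw m => by
    have hyw' : (y : ℚ_[p]) * w = 1 := by
      exact_mod_cast congrArg (fun y : ℤ_[p] => (y : ℚ_[p])) hyw
    rw [div_eq_mul_inv, ← eq_inv_of_mul_eq_one_right hyw', PadicInt.coe_mul]
  simp only [hinv hv, hinv hv', ← PadicInt.coe_mul, ← PadicInt.coe_sub]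
  rw [← PadicInt.norm_def]
  -- With `v`, `v'` inverse to the old and new denominators, the error is `h ^ 2` times a `p`-adic
  -- integer.
  have key : (n + h * n₁ + h ^ 2 * r) * v' - n * v - h * (n₁ * v - n * v * (d₁ * v)) =
      h ^ 2 * (v' * (r - t * n * v - d₁ * (n₁ * v - n * v * (d₁ * v)) -
        h * t * (n₁ * v - n * v * (d₁ * v)))) := by
    linear_combination (n * v + h * (n₁ * v - n * v * (d₁ * v))) * hv' -
      (v' * (n + h * n₁ - h * n * d₁ * v)) * hv
  rw [key, norm_mul, norm_pow]
  exact mul_le_of_le_one_right (by positivity) (PadicInt.norm_le_one _)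

theorem hasDerivAt_of_norm_sub_le_sq {f : ℚ_[p] → ℚ_[p]} {f' x : ℚ_[p]}
    (hf : ∀ y, ‖y - x‖ < 1 → ‖f y - f x - (y - x) * f'‖ ≤ ‖y - x‖ ^ 2) : HasDerivAt f f' x := by
  rw [hasDerivAt_iff_isLittleO]
  refine Asymptotics.IsBigO.trans_isLittleO ?_ (Asymptotics.isLittleO_pow_sub_sub x one_lt_two)
  refine Asymptotics.IsBigO.of_bound 1 ?_
  filter_upwards [Metric.ball_mem_nhds x one_pos] with y hy
  rw [mem_ball_iff_norm] at hy
  simpa using hf y hy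

end Derivative

/-! ### Passage to the limit. -/

section Conclusion

variable {p : ℕ} [hp : Fact p.Prime]

theorem tendstoUniformlyOn_of_norm_sub_le {f : ℕ → (Fin 3 → ℚ_[p]) → ℚ_[p]}
    {g : (Fin 3 → ℚ_[p]) → ℚ_[p]} {D : Set (Fin 3 → ℚ_[p])}
    (h : ∀ z ∈ D, ∀ s, ‖f s z - g z‖ ≤ (p : ℝ)⁻¹ ^ s) : TendstoUniformlyOn f g atTop D := by
  have hp1 : (1 : ℝ) < p := by exact_mod_cast hp.out.one_lt
  have h0 := tendsto_pow_atTop_nhds_zero_of_lt_one (r := (p : ℝ)⁻¹) (by positivity)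
    (inv_lt_one_of_one_lt₀ hp1)
  rw [Metric.tendstoUniformlyOn_iff]
  intro ε hε
  filter_upwards [h0.eventually_lt_const hε] with s hs z hz
  rw [dist_comm, dist_eq_norm]
  exact (h z hz s).trans_lt hs

/-- If the sums of the numerators are highly divisible by `p`, then the limits add up to zero. -/
theorem sum_limit_eq_zero (h2 : p ≠ 2) {N : Fin 3 → ℕ → MvPolynomial (Fin 3) ℤ}
    {g : Fin 3 → (Fin 3 → ℚ_[p]) → ℚ_[p]} (hg : ∀ i, ∀ z ∈ domain p, ∀ s,
      ‖MvPolynomial.aeval z (N i s) / MvPolynomial.aeval z (T p s) - g i z‖ ≤ (p : ℝ)⁻¹ ^ s)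
    (hN : ∀ s, (p : MvPolynomial (Fin 3) ℤ) ^ s ∣ ∑ i, N i s) {z : Fin 3 → ℚ_[p]}
    (hz : z ∈ domain p) : ∑ i, g i z = 0 := by
  -- The same sequence of sums approaches both `∑ i, g i z` and `0`.
  refine eq_of_forall_norm_sub_le
    (x := fun s => ∑ i, MvPolynomial.aeval z (N i s) / MvPolynomial.aeval z (T p s))
    (fun s => ?_) (fun s => ?_)
  · rw [← Finset.sum_sub_distrib]
    exact IsUltrametricDist.norm_sum_le_of_forall_le_of_nonneg (by positivity)
      fun i _ => hg i z hz s
  · obtain ⟨x, rfl⟩ := exists_coe_eq_of_mem_domain hz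
    obtain ⟨v, hv⟩ := (isUnit_aeval_T h2 (coe_mem_domain_iff.1 hz) s).exists_right_inv
    rw [← Finset.sum_div, ← map_sum, aeval_coe_padicInt, aeval_coe_padicInt]
    have h := norm_div_sub_le_of_pow_dvd (L := 0) (s := s) hv
      (n := MvPolynomial.aeval x (∑ i, N i s))
    rw [PadicInt.coe_zero] at h
    refine h ?_
    rw [zero_sub, dvd_neg]
    exact (pow_dvd_aeval (hN s) x).mul_right v

end Conclusion

end KZGhost

end

theorem mainTheorem10 (p : ℕ) [Fact p.Prime] (hp : p ≠ 2) :
    -- the denominators have no zeros: the rational functions are regular on the domain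
    (∀ s : ℕ, 1 ≤ s → ∀ z ∈ KZGhost.domain p, MvPolynomial.aeval z (KZGhost.T p s) ≠ 0) ∧
    ∃ (η : Fin 3 → (Fin 3 → ℚ_[p]) → ℚ_[p]) (θ : Fin 3 → Fin 3 → (Fin 3 → ℚ_[p]) → ℚ_[p]),
      (∀ i, TendstoUniformlyOn (fun s => KZGhost.etaOne p s i) (η i) atTop (KZGhost.domain p)) ∧
      (∀ i j, TendstoUniformlyOn (fun s => KZGhost.etaTwo p s i j) (θ i j) atTop
        (KZGhost.domain p)) ∧
      (∀ i, KZGhost.IsAnalyticOn (η i) (KZGhost.domain p)) ∧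
      (∀ i j, KZGhost.IsAnalyticOn (θ i j) (KZGhost.domain p)) ∧
      (∀ z ∈ KZGhost.domain p, ∑ i, η i z = 0) ∧
      (∀ z ∈ KZGhost.domain p, ∀ j, ∑ i, θ j i z = 0) ∧
      (∀ z ∈ KZGhost.domain p, ∀ i j,
        HasDerivAt (fun t : ℚ_[p] => η i (Function.update z j t))
          (θ j i z - η i z * η j z) (z j)) := by
  have hprime : p.Prime := Fact.out
  choose η hη hηa using fun i => KZGhost.exists_analytic_limit hp
    (N := fun s => MvPolynomial.pderiv i (KZGhost.T p s)) (KZGhost.pow_dvd_wronskian_T hp i)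
  choose θ hθ hθa using fun i j => KZGhost.exists_analytic_limit hp
    (N := fun s => MvPolynomial.pderiv i (MvPolynomial.pderiv j (KZGhost.T p s)))
    (KZGhost.pow_dvd_wronskian₂_T hp i j)
  refine ⟨fun s _ z hz => ?_, η, θ, fun i => KZGhost.tendstoUniformlyOn_of_norm_sub_le (hη i),
    fun i j => KZGhost.tendstoUniformlyOn_of_norm_sub_le (hθ i j), hηa, hθa,
    fun z hz => KZGhost.sum_limit_eq_zero hp hη
      (KZGhost.pow_dvd_sum_pderiv_T hprime.pos) hz,
    fun z hz j => KZGhost.sum_limit_eq_zero hp (hθ j) (fun s => ?_) hz, fun z hz i j => ?_⟩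
  · obtain ⟨x, rfl⟩ := KZGhost.exists_coe_eq_of_mem_domain hz
    rw [KZGhost.aeval_coe_padicInt]
    exact fun h0 => (KZGhost.isUnit_aeval_T hp (KZGhost.coe_mem_domain_iff.1 hz) s).ne_zero
      (PadicInt.ext h0)
  · rw [← map_sum]
    exact KZGhost.pow_dvd_derivation _ (KZGhost.pow_dvd_sum_pderiv_T hprime.pos s)
  · refine KZGhost.hasDerivAt_of_norm_sub_le_sq fun y hy => ?_
    obtain ⟨x, rfl⟩ := KZGhost.exists_coe_eq_of_mem_domain hz
    have hx := KZGhost.coe_mem_domain_iff.1 hz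
    set h : ℤ_[p] := ⟨y - x j, hy.le⟩ with hh
    have hu : ∀ k, ‖(Pi.single j h : Fin 3 → ℤ_[p]) k‖ < 1 := fun k => by
      rcases eq_or_ne k j with rfl | hkj
      · rwa [Pi.single_eq_same]
      · rw [Pi.single_eq_of_ne hkj, norm_zero]
        exact one_pos
    have hupd : Function.update (fun k => (x k : ℚ_[p])) j y =
        fun k => (((x + Pi.single j h : Fin 3 → ℤ_[p]) k : ℤ_[p]) : ℚ_[p]) := by
      funext k
      rcases eq_or_ne k j with rfl | hkj
      · rw [Function.update_self, Pi.add_apply, Pi.single_eq_same, PadicInt.coe_add]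
        simp [hh]
      · simp [hkj]
    have hmem := KZGhost.coe_mem_domain_iff.2 (KZGhost.isUnit_aeval_add hu hx)
    rw [← hupd] at hmem
    have e1 := (KZGhost.tendstoUniformlyOn_of_norm_sub_le (hη i)).tendsto_at hmem
    have e2 := (KZGhost.tendstoUniformlyOn_of_norm_sub_le (hη i)).tendsto_at hz
    have e3 := (KZGhost.tendstoUniformlyOn_of_norm_sub_le (hη j)).tendsto_at hz
    have e4 := (KZGhost.tendstoUniformlyOn_of_norm_sub_le (hθ j i)).tendsto_at hz
    rw [Function.update_eq_self]
    -- The bound `‖y - x j‖ ^ 2` does not depend on `s`, so pointwise limits suffice.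
    refine le_of_tendsto ((e1.sub e2).sub ((e4.sub (e2.mul e3)).const_mul (y - x j))).norm
      (Eventually.of_forall fun s => ?_)
    have hb := KZGhost.norm_div_sub_le_sq x j hy (h := h)
      (MvPolynomial.pderiv i (KZGhost.T p s)) (KZGhost.T p s) (KZGhost.isUnit_aeval_T hp hx s)
    simp only [hupd, KZGhost.aeval_coe_padicInt]
    exact hb
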